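/- **Theorem (Tweedie's formula in infinite-dimensional Banach spaces).** Let $B$ be a separable real Banach space with its Borel $\sigma$-algebra and let $\gamma$ be a centered Gaussian measure on $B$. Let $B^*_\gamma$ be the closure of $B^*$ in $L^2(\gamma)$, put $C_\gamma f=\int_B f(x)\,x\,d\gamma(x)\in B$ for $f\in B^*_\gamma$, and let $H(\gamma)=C_\gamma(B^*_\gamma)\subset B$ be the Cameron–Martin space, a Hilbert space with $\langle C_\gamma f,C_\gamma g\rangle_{H(\gamma)}=\int fg\,d\gamma$; let $R:H(\gamma)^*\to H(\gamma)$ be its Riesz isometry. A function $f:B\to\mathbb R$ is called Fréchet differentiable along $H(\gamma)$ at $y$, with derivative $D_{H(\gamma)}f(y)\in H(\gamma)^*$, if $h\mapsto f(y+h)$, $H(\gamma)\to\mathbb R$, is Fréchet differentiable at $0$ with this derivative. Let $X\sim\mu$ and $Z\sim\gamma$ be independent $B$-valued random variables, $Y=X+Z$, and let $\nu=\mu\star\gamma$ be the law of $Y$. Write $\gamma^x$ for the law of $Z+x$. Assume: 1. $\mu(H(\gamma))=1$; 2. $\varphi:B\to\mathbb R$ is a version of $\log\frac{d\nu}{d\gamma}$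 (that is, equal to it $\gamma$-almost everywhere) which is Fréchet differentiable along $H(\gamma)$ at $\gamma$-almost every point; 3. there are versions $p(x,\cdot)$ of $\frac{d\gamma^x}{d\gamma}$ (for $\mu$-almost every $x$), jointly measurable in $(x,y)$, such that for $\gamma$-almost every $y$ there is $\psi_y\in L^1(\mu)$ such that for $\mu$-almost every $x$ the function $p(x,\cdot)$ is Fréchet differentiable along $H(\gamma)$ at $y$ and $\|D_{H(\gamma)}\,p(x,\cdot)(y)\|_{H(\gamma)^*}\le\psi_y(x)$. Then for $\nu$-almost every $y$ the regular conditional distribution of $X$ given $Y=y$ has a (Bochner) mean $\mathbb E[X\mid Y=y]$, and $$\mathbb E[X\mid Y=y]=R\bigl(D_{H(\gamma)}\varphi(y)\bigr)=R\Bigl(D_{H(\gamma)}\log\tfrac{d\nu}{d\gamma}(y)\Bigr).$$ In particular, if $\mathbb E\|X\|<\infty$, then $\mathbb E[X\mid\sigma(Y)]=R\bigl(D_{H(\gamma)}\varphi(Y)\bigr)$ almost surely. -/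

import Mathlib

open MeasureTheory ProbabilityTheory
open scoped ENNReal

noncomputable section

namespace Tweedie

section CameronMartin

variable {B : Type*} [NormedAddCommGroup B] [NormedSpace ℝ B] [CompleteSpace B]
  [SecondCountableTopology B] [MeasurableSpace B] [BorelSpace B]

/-- The reproducing kernel Hilbert space `B*_γ` of a centered Gaussian measure `γ`: the closure
of the dual space `B*` in `L²(γ)`, with the inner product of `L²(γ)`. -/
def rkhs (γ : Measure B) : Submodule ℝ (Lp ℝ 2 γ) :=
  (LinearMap.range (StrongDual.toLpₗ (𝕜 := ℝ) γ 2)).topologicalClosure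

lemma integrable_smul_id (γ : Measure B) [IsGaussian γ] (f : Lp ℝ 2 γ) :
    Integrable (fun x => f x • x) γ :=
  memLp_one_iff_integrable.mp
    (MemLp.smul (p := 2) (q := 2) (IsGaussian.memLp_id γ 2 (by norm_num)) (Lp.memLp f))

/-- The covariance operator `C_γ f = ∫ f(x) x dγ(x)`. As a Bochner integral it is the element
of `B` with `g (C_γ f) = ∫ f g dγ` for all `g ∈ B*`. -/
def covOp (γ : Measure B) [IsGaussian γ] : Lp ℝ 2 γ →ₗ[ℝ] B where
  toFun f := ∫ x, f x • x ∂γ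
  map_add' f g := by
    rw [← integral_add (integrable_smul_id γ f) (integrable_smul_id γ g)]
    refine integral_congr_ae ?_
    filter_upwards [Lp.coeFn_add f g] with x hx
    rw [hx, Pi.add_apply, add_smul]
  map_smul' c f := by
    rw [RingHom.id_apply, ← integral_smul]
    refine integral_congr_ae ?_
    filter_upwards [Lp.coeFn_smul c f] with x hx
    rw [hx, Pi.smul_apply, smul_eq_mul, mul_smul]

lemma apply_covOp (γ : Measure B) [IsGaussian γ] (f : Lp ℝ 2 γ) (g : StrongDual ℝ B) :
    g (covOp γ f) = ∫ x, f x * g x ∂γ := by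
  change g (∫ x, f x • x ∂γ) = _
  rw [← g.integral_comp_comm (integrable_smul_id γ f)]
  simp

lemma covOp_injOn (γ : Measure B) [IsGaussian γ] {f : Lp ℝ 2 γ} (hf : f ∈ rkhs γ)
    (h0 : covOp γ f = 0) : f = 0 := by
  have hm : MemLp id 2 γ := IsGaussian.memLp_id γ 2 (by norm_num)
  have h1 : (LinearMap.range (StrongDual.toLpₗ (𝕜 := ℝ) γ 2)) ≤ (ℝ ∙ f)ᗮ := by
    rintro _ ⟨g, rfl⟩
    rw [Submodule.mem_orthogonal_singleton_iff_inner_right, L2.inner_def]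
    have h2 := apply_covOp γ f g
    rw [h0, map_zero] at h2
    rw [h2]
    refine integral_congr_ae ?_
    rw [StrongDual.toLpₗ_apply hm]
    filter_upwards [MemLp.coeFn_toLp (f := ⇑g) (hm.continuousLinearMap_comp g)] with x hx
    rw [hx]
    simp [mul_comm]
  have h3 := Submodule.topologicalClosure_minimal _ h1 (Submodule.isClosed_orthogonal _) hf
  rw [Submodule.mem_orthogonal_singleton_iff_inner_right] at h3
  exact inner_self_eq_zero.mp h3

/-- The Cameron–Martin space `H(γ) = C_γ(B*_γ)`, as a linear subspace of `B`. -/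
def cameronMartin (γ : Measure B) [IsGaussian γ] : Submodule ℝ B :=
  (rkhs γ).map (covOp γ)

/-- The Cameron–Martin space as a type of its own, so that it can carry the Hilbert norm
`|C_γ f|_{H(γ)} = ‖f‖_{L²(γ)}` instead of the norm of `B`. -/
def CM (γ : Measure B) [IsGaussian γ] : Type _ := cameronMartin γ

instance (γ : Measure B) [IsGaussian γ] : AddCommGroup (CM γ) :=
  inferInstanceAs (AddCommGroup (cameronMartin γ))

instance (γ : Measure B) [IsGaussian γ] : Module ℝ (CM γ) :=
  inferInstanceAs (Module ℝ (cameronMartin γ))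

/-- The inclusion `H(γ) → B`. -/
def CM.incl (γ : Measure B) [IsGaussian γ] : CM γ →ₗ[ℝ] B := (cameronMartin γ).subtype

/-- The bijection `C_γ : B*_γ → H(γ)`. -/
def CM.covEquiv (γ : Measure B) [IsGaussian γ] : rkhs γ ≃ₗ[ℝ] CM γ :=
  LinearEquiv.ofBijective
    (((covOp γ).restrict (p := rkhs γ) (q := cameronMartin γ)
      (fun _ hx => Submodule.mem_map_of_mem hx)) : rkhs γ →ₗ[ℝ] cameronMartin γ)
    ⟨(injective_iff_map_eq_zero _).mpr (fun f hf =>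
        Subtype.ext (covOp_injOn γ f.2 (congrArg Subtype.val hf))),
      by
        rintro ⟨_, f, hf, rfl⟩
        exact ⟨⟨f, hf⟩, rfl⟩⟩

lemma CM.incl_covEquiv (γ : Measure B) [IsGaussian γ] (f : rkhs γ) :
    CM.incl γ (CM.covEquiv γ f) = covOp γ f := rfl

instance (γ : Measure B) [IsGaussian γ] : NormedAddCommGroup (CM γ) :=
  NormedAddCommGroup.induced (CM γ) (rkhs γ) (CM.covEquiv γ).symm (CM.covEquiv γ).symm.injective

/-- The inner product `⟨C_γ f, C_γ g⟩_{H(γ)} = ∫ f g dγ`. -/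
instance (γ : Measure B) [IsGaussian γ] : InnerProductSpace ℝ (CM γ) :=
  { (NormedSpace.induced ℝ (CM γ) (rkhs γ) (CM.covEquiv γ).symm : NormedSpace ℝ (CM γ)) with
    inner := fun h k => inner ℝ ((CM.covEquiv γ).symm h) ((CM.covEquiv γ).symm k)
    norm_sq_eq_re_inner := fun h => norm_sq_eq_re_inner (𝕜 := ℝ) ((CM.covEquiv γ).symm h)
    conj_inner_symm := fun _ _ => inner_conj_symm _ _
    add_left := fun h k l => by
      simp only [map_add, inner_add_left]
    smul_left := fun h k c => by
      rw [map_smul]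
      exact inner_smul_left (𝕜 := ℝ) ((CM.covEquiv γ).symm h) ((CM.covEquiv γ).symm k) c }

lemma CM.inner_covEquiv (γ : Measure B) [IsGaussian γ] (f g : rkhs γ) :
    inner ℝ (CM.covEquiv γ f) (CM.covEquiv γ g) = inner ℝ f g := by
  change inner ℝ ((CM.covEquiv γ).symm _) ((CM.covEquiv γ).symm _) = _
  simp

/-- `C_γ : B*_γ → H(γ)` as an isometric isomorphism. -/
def CM.covIsometry (γ : Measure B) [IsGaussian γ] : rkhs γ ≃ₗᵢ[ℝ] CM γ :=
  (CM.covEquiv γ).isometryOfInner (CM.inner_covEquiv γ)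

instance (γ : Measure B) : CompleteSpace (rkhs γ) :=
  (Submodule.isClosed_topologicalClosure _).completeSpace_coe

instance (γ : Measure B) [IsGaussian γ] : CompleteSpace (CM γ) :=
  (completeSpace_congr (e := (CM.covIsometry γ).toEquiv)
    (CM.covIsometry γ).isometry.isUniformEmbedding).mp inferInstance

/-- The Riesz isometry `R : H(γ)* → H(γ)`. -/
def riesz (γ : Measure B) [IsGaussian γ] (L : StrongDual ℝ (CM γ)) : CM γ :=
  (InnerProductSpace.toDual ℝ (CM γ)).symm L

/-- `f : B → ℝ` is Fréchet differentiable along `H(γ)` at `y`: the map `h ↦ f (y + h)` on the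
Hilbert space `H(γ)` is Fréchet differentiable at `0`. -/
def DifferentiableAlongAt (γ : Measure B) [IsGaussian γ] (f : B → ℝ) (y : B) : Prop :=
  DifferentiableAt ℝ (fun h : CM γ => f (y + CM.incl γ h)) 0

/-- The Fréchet derivative `D_{H(γ)} f (y) ∈ H(γ)*` of `f` along `H(γ)` at `y`. -/
def derivAlong (γ : Measure B) [IsGaussian γ] (f : B → ℝ) (y : B) : StrongDual ℝ (CM γ) :=
  fderiv ℝ (fun h : CM γ => f (y + CM.incl γ h)) 0

end CameronMartin

end Tweedie

end

/-! ### Cameron–Martin shifts of `γ`. -/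

namespace Tweedie

/-! Since `μ` lives on `H(γ)`, each `γ^x` has a density `p x`, so Bayes' formula gives `p x y μ(dx)
/ q y`, with `q y = ∫ p x y μ(dx)`, as the law of `X` given `Y = y`; moreover `φ = log q` a.e. The
key identity is `p x (y + C_γ g) = exp (g x) * p x y` for `g ∈ B*` (`rnDeriv_map_add_shift`). Hence
`t ↦ q (y + t C_γ g)` is the Laplace transform of `g` under `p x y μ(dx)`, and its logarithmic
derivative at `0` is the conditional mean of `g X`. That derivative is also `Dφ(y)(C_γ g) = ⟨R
Dφ(y), C_γ g⟩ = g (R Dφ(y))`. Testing against a norming family of `g` identifies the mean.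

The bound `ψ` serves only Bochner integrability: the derivative of `p x` at `y` along `C_γ g` is `g
x * p x y`, so `‖x‖ |p x y|` is at most a constant times `ψ x`. Differentiating the Laplace
transform needs only its finiteness near `0`.

All identities hold merely almost everywhere, so they are used for countably many `g` and rational
`t`; the assumed differentiability makes this enough (`derivAlong_ofDual_eq`). -/

lemma integral_cexp_mul_exp {B : Type*} [NormedAddCommGroup B] [NormedSpace ℝ B]
    [MeasurableSpace B] [BorelSpace B] (γ : Measure B) [IsGaussian γ]
    (hγ : ∀ L : StrongDual ℝ B, ∫ z, L z ∂γ = 0)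
    (g L : StrongDual ℝ B) :
    ∫ y, Complex.exp (L y * Complex.I) * Complex.exp (g y) ∂γ =
      Complex.exp ((Var[g; γ] - Var[L; γ]) / 2 + cov[g, L; γ] * Complex.I) := by
  have hg : MemLp g 2 γ := IsGaussian.memLp_dual γ g 2 (by norm_num)
  have hL : MemLp L 2 γ := IsGaussian.memLp_dual γ L 2 (by norm_num)
  set c := cov[g, L; γ] with hc
  set v := Var[g; γ] with hv
  -- The regression coefficient: `L - a • g` is uncorrelated with `g`, hence independent of it by
  -- joint Gaussianity. If `Var[g] = 0`, then `g = 0` a.e., so `c = 0`.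
  obtain ⟨a, ha⟩ : ∃ a : ℝ, a * v = c := by
    by_cases h0 : v = 0
    · refine ⟨0, ?_⟩
      have h1 : g =ᵐ[γ] fun _ => 0 := by
        have := ae_eq_integral_of_variance_eq_zero hg h0
        filter_upwards [this] with y hy
        rw [hy, hγ]
      rw [zero_mul, hc, covariance, hγ, hγ]
      symm
      refine integral_eq_zero_of_ae ?_
      filter_upwards [h1] with y hy
      simp [hy]
    · exact ⟨c / v, by field_simp⟩
  set L' : StrongDual ℝ B := L - a • g with hL'
  have hag : MemLp (⇑(a • g)) 2 γ := IsGaussian.memLp_dual γ _ 2 (by norm_num)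
  have hag' : ⇑(a • g) = fun y => a * g y := rfl
  have hcoe : ⇑L' = ⇑L - ⇑(a • g) := rfl
  have hcov : cov[g, L'; γ] = 0 := by
    rw [hcoe, covariance_sub_right hg hL hag, hag', covariance_const_mul_right,
      covariance_self hg.aemeasurable, ← hc, ← hv, ha, sub_self]
  have hvar : Var[L'; γ] = Var[L; γ] - a * c := by
    rw [hcoe, variance_sub hL hag, hag', covariance_const_mul_right, variance_const_mul,
      covariance_comm, ← hc, ← hv]
    linear_combination a * ha
  have hpair : HasGaussianLaw (fun y => (g y, L' y)) γ :=
    IsGaussian.hasGaussianLaw_id.map_fun (g.prod L')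
  have hind := hpair.indepFun_of_covariance_eq_zero hcov
  have hmap (K : StrongDual ℝ B) (z : ℂ) :
      ∫ y, Complex.exp (z * K y) ∂γ = Complex.exp (Var[K; γ] * z ^ 2 / 2) := by
    have h := complexMGF_gaussianReal (IsGaussian.map_eq_gaussianReal (μ := γ) K) z
    rw [hγ, Real.coe_toNNReal _ (variance_nonneg _ _)] at h
    simpa [complexMGF] using h
  have hprod := (hind.comp (φ := fun s : ℝ => Complex.exp ((1 + a * Complex.I) * s))
    (ψ := fun s : ℝ => Complex.exp (Complex.I * s)) (by fun_prop)
    (by fun_prop)).integral_fun_mul_eq_mul_integral (by fun_prop) (by fun_prop)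
  simp only [Function.comp_apply] at hprod
  rw [hmap, hmap, hvar] at hprod
  calc _ = ∫ y, Complex.exp ((1 + a * Complex.I) * g y) * Complex.exp (Complex.I * L' y) ∂γ := by
        congr with y
        rw [← Complex.exp_add, ← Complex.exp_add, hcoe, hag']
        congr 1
        simp only [Pi.sub_apply]
        push_cast
        ring
    _ = _ := by
        rw [hprod, ← Complex.exp_add, ← hv]
        congr 1
        have ha' : (a : ℂ) * v = c := by exact_mod_cast ha
        push_cast
        linear_combination (Complex.I + a * Complex.I ^ 2 / 2) * ha' +
          (Var[L; γ] / 2 : ℂ) * Complex.I_sq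

variable {B : Type*} [NormedAddCommGroup B] [NormedSpace ℝ B] [CompleteSpace B]
  [SecondCountableTopology B] [MeasurableSpace B] [BorelSpace B]

/-- The covariance operator on the dual space: `g ↦ C_γ g`, with values in `H(γ)`. -/
noncomputable def CM.ofDual (γ : Measure B) [IsGaussian γ] : StrongDual ℝ B →ₗ[ℝ] CM γ :=
  (CM.covEquiv γ).toLinearMap ∘ₗ (StrongDual.toLpₗ (𝕜 := ℝ) γ 2).codRestrict (rkhs γ)
    (fun g => Submodule.le_topologicalClosure _ ⟨g, rfl⟩)

variable (γ : Measure B) [IsGaussian γ]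

lemma coeFn_toLp (g : StrongDual ℝ B) : ⇑(StrongDual.toLpₗ (𝕜 := ℝ) γ 2 g) =ᵐ[γ] g := by
  have hm : MemLp id 2 γ := IsGaussian.memLp_id γ 2 (by norm_num)
  rw [StrongDual.toLpₗ_apply hm]
  exact MemLp.coeFn_toLp (f := ⇑g) (hm.continuousLinearMap_comp g)

lemma CM.incl_ofDual (g : StrongDual ℝ B) :
    CM.incl γ (CM.ofDual γ g) = covOp γ (StrongDual.toLpₗ (𝕜 := ℝ) γ 2 g) := rfl

lemma CM.apply_incl_ofDual (g L : StrongDual ℝ B) :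
    L (CM.incl γ (CM.ofDual γ g)) = ∫ y, g y * L y ∂γ := by
  rw [CM.incl_ofDual, apply_covOp]
  refine integral_congr_ae ?_
  filter_upwards [coeFn_toLp γ g] with x hx
  rw [hx]

lemma CM.apply_incl_ofDual_eq_covariance (hγ : ∀ L : StrongDual ℝ B, ∫ z, L z ∂γ = 0)
    (g L : StrongDual ℝ B) : L (CM.incl γ (CM.ofDual γ g)) = cov[g, L; γ] := by
  rw [CM.apply_incl_ofDual, covariance, hγ, hγ]
  simp

/-- The reproducing property, through which the Riesz representative is tested by elements of `B*`.
-/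
lemma CM.inner_ofDual (x : CM γ) (g : StrongDual ℝ B) :
    inner ℝ x (CM.ofDual γ g) = g (CM.incl γ x) := by
  obtain ⟨f, rfl⟩ := (CM.covEquiv γ).surjective x
  rw [CM.incl_covEquiv, apply_covOp]
  change inner ℝ (CM.covEquiv γ f) (CM.covEquiv γ ⟨StrongDual.toLpₗ (𝕜 := ℝ) γ 2 g, _⟩) = _
  rw [CM.inner_covEquiv, Submodule.coe_inner, L2.inner_def]
  refine integral_congr_ae ?_
  filter_upwards [coeFn_toLp γ g] with y hy
  simp [hy, mul_comm]

lemma CM.norm_ofDual_le (g : StrongDual ℝ B) :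
    ‖CM.ofDual γ g‖ ≤ ‖g‖ * (eLpNorm id 2 γ).toReal := by
  have h : ‖CM.ofDual γ g‖ = ‖StrongDual.toLpₗ (𝕜 := ℝ) γ 2 g‖ := by
    have := (CM.covIsometry γ).norm_map
      ⟨StrongDual.toLpₗ (𝕜 := ℝ) γ 2 g, Submodule.le_topologicalClosure _ ⟨g, rfl⟩⟩
    exact this
  rw [h]
  exact StrongDual.norm_toLpₗ_le g

/-- The Cameron–Martin formula for shifts by `C_γ g`, `g ∈ B*`. -/
lemma map_add_ofDual (hγ : ∀ L : StrongDual ℝ B, ∫ z, L z ∂γ = 0) (g : StrongDual ℝ B) :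
    γ.map (fun y => y + CM.incl γ (CM.ofDual γ g)) =
      γ.withDensity (fun y => ENNReal.ofReal (Real.exp (g y - Var[g; γ] / 2))) := by
  have hmgf : mgf g γ 1 = Real.exp (Var[g; γ] / 2) := by
    have h := mgf_gaussianReal (IsGaussian.map_eq_gaussianReal (μ := γ) g) 1
    rwa [hγ, Real.coe_toNNReal _ (variance_nonneg _ _), zero_mul, zero_add, one_pow, mul_one] at h
  have hint : Integrable (fun y => Real.exp (g y - Var[g; γ] / 2)) γ := by
    have h : Integrable (fun y => Real.exp (1 * g y)) γ := by
      by_contra h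
      have h0 := mgf_undef h
      rw [hmgf] at h0
      exact (Real.exp_pos _).ne' h0
    simp only [one_mul] at h
    simpa [Real.exp_sub] using h.div_const _
  have : IsFiniteMeasure
      (γ.withDensity (fun y => ENNReal.ofReal (Real.exp (g y - Var[g; γ] / 2)))) :=
    isFiniteMeasure_withDensity_ofReal hint.2
  have : IsProbabilityMeasure (γ.map (fun y => y + CM.incl γ (CM.ofDual γ g))) :=
    Measure.isProbabilityMeasure_map (by fun_prop)
  refine Measure.ext_of_charFunDual (funext fun L => ?_)
  rw [charFunDual_apply, charFunDual_apply, integral_map (by fun_prop) (by fun_prop),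
    integral_withDensity_eq_integral_toReal_smul (by fun_prop) (by simp)]
  have h1 := integral_cexp_mul_exp γ hγ g L
  have h2 := integral_cexp_mul_exp γ hγ 0 L
  have h3 : ⇑(0 : StrongDual ℝ B) = 0 := rfl
  simp only [h3, Pi.zero_apply, Complex.ofReal_zero, Complex.exp_zero, mul_one, variance_zero,
    covariance_zero_left, zero_mul, add_zero] at h2
  calc _ = Complex.exp (cov[g, L; γ] * Complex.I) * ∫ y, Complex.exp (L y * Complex.I) ∂γ := by
        rw [← integral_const_mul]
        congr with y
        rw [map_add, CM.apply_incl_ofDual_eq_covariance γ hγ, ← Complex.exp_add]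
        push_cast
        ring_nf
    _ = Complex.exp (-(Var[g; γ] / 2)) *
          ∫ y, Complex.exp (L y * Complex.I) * Complex.exp (g y) ∂γ := by
        rw [h1, h2, ← Complex.exp_add, ← Complex.exp_add]
        ring_nf
    _ = _ := by
        rw [← integral_const_mul]
        congr with y
        rw [ENNReal.toReal_ofReal (Real.exp_nonneg _), Complex.real_smul, Complex.ofReal_exp,
          ← Complex.exp_add, ← Complex.exp_add, ← Complex.exp_add]
        push_cast
        ring_nf

/-- Cauchy–Schwarz against the Cameron–Martin density. The bound sees `g` only through its variance,
so it survives `L²` limits of functionals. -/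
lemma map_add_ofDual_apply_le (hγ : ∀ L : StrongDual ℝ B, ∫ z, L z ∂γ = 0) (g : StrongDual ℝ B)
    {U : Set B} (hU : MeasurableSet U) :
    γ.map (fun y => y + CM.incl γ (CM.ofDual γ g)) U ≤
      ENNReal.ofReal (Real.exp (Var[g; γ] / 2)) * γ U ^ (1 / 2 : ℝ) := by
  set F : B → ℝ≥0∞ := fun y => ENNReal.ofReal (Real.exp (g y - Var[g; γ] / 2)) with hF
  have hFm : Measurable F := by fun_prop
  -- `F²` is `exp (Var[g])` times the density of the shift by `C_γ (2g)`, which has total mass `1`.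
  have hF2 : ∫⁻ y, F y ^ (2 : ℝ) ∂γ = ENNReal.ofReal (Real.exp (Var[g; γ])) := by
    have h := map_add_ofDual γ hγ ((2 : ℝ) • g)
    have hv : Var[⇑((2 : ℝ) • g); γ] = 4 * Var[g; γ] := by
      change Var[fun y => 2 * g y; γ] = _
      rw [variance_const_mul]; norm_num
    have : IsProbabilityMeasure (γ.map (fun y => y + CM.incl γ (CM.ofDual γ ((2 : ℝ) • g)))) :=
      Measure.isProbabilityMeasure_map (by fun_prop)
    have h1 := congrArg (fun m : Measure B => m Set.univ) h
    simp only [measure_univ, withDensity_apply _ MeasurableSet.univ, Measure.restrict_univ] at h1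
    rw [← mul_one (ENNReal.ofReal (Real.exp Var[g; γ])), h1, ← lintegral_const_mul _ (by fun_prop)]
    congr with y
    rw [hF, ENNReal.ofReal_rpow_of_pos (Real.exp_pos _), ← ENNReal.ofReal_mul (Real.exp_nonneg _),
      ← Real.exp_add, ← Real.exp_mul, hv]
    congr 2
    change _ = Var[g; γ] + ((2 : ℝ) * g y - _)
    ring
  rw [map_add_ofDual γ hγ g, withDensity_apply _ hU, ← lintegral_indicator hU]
  calc ∫⁻ y, U.indicator F y ∂γ = ∫⁻ y, (F * U.indicator (1 : B → ℝ≥0∞)) y ∂γ := by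
        congr with y
        by_cases hy : y ∈ U <;> simp [hy]
    _ ≤ (∫⁻ y, F y ^ (2 : ℝ) ∂γ) ^ (1 / 2 : ℝ) *
          (∫⁻ y, (U.indicator (1 : B → ℝ≥0∞) y) ^ (2 : ℝ) ∂γ) ^ (1 / 2 : ℝ) :=
        ENNReal.lintegral_mul_le_Lp_mul_Lq _ Real.HolderConjugate.two_two hFm.aemeasurable
          (measurable_one.indicator hU).aemeasurable
    _ = _ := by
        have h2 : ∫⁻ y, (U.indicator (1 : B → ℝ≥0∞) y) ^ (2 : ℝ) ∂γ = γ U := by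
          rw [← lintegral_indicator_one hU]
          congr with y
          by_cases hy : y ∈ U <;> simp [hy]
        rw [h2, hF2, ENNReal.ofReal_rpow_of_pos (Real.exp_pos _), ← Real.exp_mul]
        ring_nf

lemma norm_covOp_le (f : Lp ℝ 2 γ) : ‖covOp γ f‖ ≤ ‖f‖ * (eLpNorm id 2 γ).toReal := by
  obtain ⟨L, hL, hLx⟩ := exists_dual_vector'' ℝ (covOp γ f)
  have h1 : L (covOp γ f) = inner ℝ f (StrongDual.toLpₗ (𝕜 := ℝ) γ 2 L) := by
    rw [apply_covOp, L2.inner_def]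
    refine integral_congr_ae ?_
    filter_upwards [coeFn_toLp γ L] with y hy
    simp [hy, mul_comm]
  have h2 : ‖covOp γ f‖ = L (covOp γ f) := by simpa using hLx.symm
  rw [h2, h1]
  refine (real_inner_le_norm _ _).trans ?_
  gcongr
  refine (StrongDual.norm_toLpₗ_le L).trans ?_
  exact mul_le_of_le_one_left ENNReal.toReal_nonneg hL

/-- Shifts of `γ` along `H(γ)` are absolutely continuous with respect to `γ`. -/
lemma map_add_absolutelyContinuous (hγ : ∀ L : StrongDual ℝ B, ∫ z, L z ∂γ = 0) {x : B}
    (hx : x ∈ cameronMartin γ) : γ.map (fun y => y + x) ≪ γ := by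
  obtain ⟨f, hf, rfl⟩ := hx
  obtain ⟨u, hu, hlim⟩ := mem_closure_iff_seq_limit.mp hf
  choose g hg using hu
  obtain rfl : (fun n => StrongDual.toLpₗ (𝕜 := ℝ) γ 2 (g n)) = u := funext hg
  have hvar (n : ℕ) : Var[g n; γ] = ‖StrongDual.toLpₗ (𝕜 := ℝ) γ 2 (g n)‖ ^ 2 := by
    rw [← covariance_self (g n).measurable.aemeasurable,
      ← CM.apply_incl_ofDual_eq_covariance γ hγ, CM.apply_incl_ofDual, ← real_inner_self_eq_norm_sq,
      L2.inner_def]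
    refine integral_congr_ae ?_
    filter_upwards [coeFn_toLp γ (g n)] with y hy
    simp [hy, sq]
  obtain ⟨C, hC⟩ : ∃ C : ℝ, ∀ n, Var[g n; γ] ≤ C := by
    obtain ⟨C, hC⟩ := (hlim.norm.pow 2).bddAbove_range
    exact ⟨C, fun n => (hvar n).trans_le (hC ⟨n, rfl⟩)⟩
  have hcov : Filter.Tendsto (fun n => CM.incl γ (CM.ofDual γ (g n))) Filter.atTop
      (nhds (covOp γ f)) := by
    rw [tendsto_iff_norm_sub_tendsto_zero] at hlim ⊢
    refine squeeze_zero (fun _ => norm_nonneg _) (fun n => ?_)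
      (by simpa using hlim.mul_const (eLpNorm id 2 γ).toReal)
    rw [CM.incl_ofDual, ← map_sub]
    exact norm_covOp_le γ _
  -- The indicator of an open set is lower semicontinuous, so Fatou's lemma carries the uniform
  -- bound from `C_γ (g n)` to its limit.
  have hopen (U : Set B) (hU : IsOpen U) : γ.map (fun y => y + covOp γ f) U ≤
      ENNReal.ofReal (Real.exp (C / 2)) * γ U ^ (1 / 2 : ℝ) := by
    have hpre (w : B) : MeasurableSet ((fun y => y + w) ⁻¹' U) :=
      (measurable_id.add_const w) hU.measurableSet
    calc γ.map (fun y => y + covOp γ f) U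
        = ∫⁻ y, ((fun y => y + covOp γ f) ⁻¹' U).indicator 1 y ∂γ := by
          rw [lintegral_indicator_one (hpre _), Measure.map_apply (by fun_prop) hU.measurableSet]
      _ ≤ ∫⁻ y, Filter.liminf (fun n =>
            ((fun y => y + CM.incl γ (CM.ofDual γ (g n))) ⁻¹' U).indicator (1 : B → ℝ≥0∞) y)
            Filter.atTop ∂γ := by
          refine lintegral_mono fun y => ?_
          by_cases hy : y + covOp γ f ∈ U
          · refine Filter.le_liminf_of_le (by isBoundedDefault) ?_
            filter_upwards [(hcov.const_add y).eventually (hU.mem_nhds hy)] with n hn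
            have hn' : y + CM.incl γ (CM.ofDual γ (g n)) ∈ U := hn
            simp [hy, hn']
          · simp [hy]
      _ ≤ Filter.liminf (fun n => ∫⁻ y,
            ((fun y => y + CM.incl γ (CM.ofDual γ (g n))) ⁻¹' U).indicator (1 : B → ℝ≥0∞) y ∂γ)
            Filter.atTop :=
          lintegral_liminf_le fun n => measurable_one.indicator (hpre _)
      _ ≤ _ := by
          refine Filter.liminf_le_of_le (by isBoundedDefault) fun b hb => ?_
          obtain ⟨n, hn⟩ := hb.exists
          refine hn.trans ?_
          rw [lintegral_indicator_one (hpre _), ← Measure.map_apply (by fun_prop) hU.measurableSet]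
          refine (map_add_ofDual_apply_le γ hγ (g n) hU.measurableSet).trans ?_
          gcongr
          exact hC n
  refine Measure.AbsolutelyContinuous.mk fun s _ hs => ?_
  refine le_antisymm ?_ zero_le
  -- Outer regularity: a null set lies in open sets of measure below any `r > 0`, and the bound
  -- tends to `0` with `r`.
  have hlim0 : Filter.Tendsto (fun r : ℝ≥0∞ => ENNReal.ofReal (Real.exp (C / 2)) * r ^ (1 / 2 : ℝ))
      (nhdsWithin 0 (Set.Ioi 0)) (nhds 0) := by
    have h1 : Filter.Tendsto (fun r : ℝ≥0∞ => r ^ (1 / 2 : ℝ)) (nhds 0) (nhds 0) := by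
      simpa using (ENNReal.continuous_rpow_const (y := 1 / 2)).tendsto (0 : ℝ≥0∞)
    simpa using (ENNReal.Tendsto.const_mul h1 (Or.inr ENNReal.ofReal_ne_top)).mono_left
      nhdsWithin_le_nhds
  refine ge_of_tendsto hlim0 ?_
  filter_upwards [self_mem_nhdsWithin] with r hr
  obtain ⟨U, hsU, hU, hUr⟩ := s.exists_isOpen_lt_of_lt (μ := γ) r (hs.trans_lt hr)
  exact (measure_mono hsU).trans ((hopen U hU).trans (by gcongr))

end Tweedie

/-! ### Bayes' formula. -/

namespace Tweedie

section Density

lemma map_withDensity_comp {α β : Type*} [MeasurableSpace α] [MeasurableSpace β] (m : Measure α)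
    {T : α → β} (hT : Measurable T) {F : β → ℝ≥0∞} (hF : Measurable F) :
    (m.withDensity (F ∘ T)).map T = (m.map T).withDensity F := by
  ext s hs
  rw [Measure.map_apply hT hs, withDensity_apply _ (hT hs), withDensity_apply _ hs,
    setLIntegral_map hs hF hT]
  rfl

/-- Bayes' formula: if `(Y, X)` has the density `f` with respect to `γ ⊗ μ`, then the law of `Y`
has the density `∫ f(·, x) dμ(x)` with respect to `γ`. -/
lemma map_eq_withDensity_lintegral {Ω α β : Type*} [MeasurableSpace Ω] [MeasurableSpace α]
    [MeasurableSpace β] {P : Measure Ω} {X : Ω → α} {Y : Ω → β} (hX : Measurable X)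
    (hY : Measurable Y) {μ : Measure α} {γ : Measure β} [SFinite μ] [SFinite γ]
    {f : β → α → ℝ≥0∞} (hf : Measurable (Function.uncurry f))
    (h : P.map (fun ω => (Y ω, X ω)) = (γ.prod μ).withDensity (Function.uncurry f)) :
    P.map Y = γ.withDensity (fun y => ∫⁻ x, f y x ∂μ) := by
  ext s hs
  have h1 : P.map Y s = P.map (fun ω => (Y ω, X ω)) (s ×ˢ Set.univ) := by
    rw [Measure.map_apply hY hs, Measure.map_apply (hY.prodMk hX) (hs.prod MeasurableSet.univ)]
    congr 1
    ext
    simp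
  rw [h1, h, withDensity_apply _ (hs.prod MeasurableSet.univ), withDensity_apply _ hs,
    ← Measure.prod_restrict, Measure.restrict_univ, lintegral_prod _ hf.aemeasurable]
  rfl

/-- Bayes' formula for the conditional law of `X` given `Y`. -/
lemma condDistrib_ae_eq_withDensity {Ω α β : Type*} [MeasurableSpace Ω] [MeasurableSpace α]
    [StandardBorelSpace α] [Nonempty α] [MeasurableSpace β] {P : Measure Ω} [IsFiniteMeasure P]
    {X : Ω → α} {Y : Ω → β} (hX : Measurable X) (hY : Measurable Y) {μ : Measure α}
    {γ : Measure β} [SFinite μ] [SFinite γ]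
    {f : β → α → ℝ≥0∞} (hf : Measurable (Function.uncurry f))
    (h : P.map (fun ω => (Y ω, X ω)) = (γ.prod μ).withDensity (Function.uncurry f)) :
    ∀ᵐ y ∂P.map Y, condDistrib X Y P y =
      μ.withDensity (fun x => f y x * (∫⁻ x', f y x' ∂μ)⁻¹) := by
  set q : β → ℝ≥0∞ := fun y => ∫⁻ x, f y x ∂μ with hq
  have hqm : Measurable q := hf.lintegral_prod_right'
  have hfy (y : β) : Measurable (f y) := hf.of_uncurry_left
  have hmap := map_eq_withDensity_lintegral hX hY hf h
  have hkm : Measurable (Function.uncurry fun y x => f y x * (q y)⁻¹) :=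
    hf.mul (hqm.comp measurable_fst).inv
  let η : Kernel β α := (Kernel.const β μ).withDensity (fun y x => f y x * (q y)⁻¹)
  have hη (y : β) : η y = μ.withDensity (fun x => f y x * (q y)⁻¹) := by
    simp only [η]
    rw [Kernel.withDensity_apply _ hkm, Kernel.const_apply]
  -- With `0⁻¹ = ∞`, `∞⁻¹ = 0` and `0 * ∞ = 0`, the mass `q y * (q y)⁻¹` is at most `1` for every
  -- `y`.
  have : IsFiniteKernel η := by
    refine ⟨⟨1, ENNReal.one_lt_top, fun y => ?_⟩⟩
    rw [hη, withDensity_apply _ MeasurableSet.univ, Measure.restrict_univ,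
      lintegral_mul_const _ (hfy y)]
    exact ENNReal.mul_inv_le_one _
  have hqtop : ∀ᵐ y ∂γ, q y < ∞ := by
    refine ae_lt_top hqm ?_
    rw [← setLIntegral_univ, ← withDensity_apply _ MeasurableSet.univ, ← hmap]
    exact measure_ne_top _ _
  have key : P.map (fun ω => (Y ω, X ω)) = P.map Y ⊗ₘ η := by
    rw [h, hmap]
    ext s hs
    rw [Measure.compProd_apply hs, lintegral_withDensity_eq_lintegral_mul _ hqm
      (Kernel.measurable_kernel_prodMk_left hs), withDensity_apply _ hs, ← lintegral_indicator hs,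
      lintegral_prod _ (hf.indicator hs).aemeasurable]
    refine lintegral_congr_ae ?_
    filter_upwards [hqtop] with y hy
    have hs' : MeasurableSet (Prod.mk y ⁻¹' s) := measurable_prodMk_left hs
    have h1 : ∫⁻ x, s.indicator (Function.uncurry f) (y, x) ∂μ =
        ∫⁻ x in Prod.mk y ⁻¹' s, f y x ∂μ := by
      rw [← lintegral_indicator hs']
      rfl
    rw [h1, Pi.mul_apply, hη, withDensity_apply _ hs', lintegral_mul_const _ (hfy y)]
    rcases eq_or_ne (q y) 0 with h0 | h0
    · rw [h0, zero_mul]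
      exact le_antisymm ((setLIntegral_le_lintegral _ _).trans_eq h0) zero_le
    · rw [mul_comm, mul_assoc, ENNReal.inv_mul_cancel h0 hy.ne, mul_one]
  filter_upwards [condDistrib_ae_eq_of_measure_eq_compProd Y hX.aemeasurable key] with y hy
  rw [hy, hη]

end Density

/-! ### Densities along Cameron–Martin shifts. -/

variable {B : Type*} [NormedAddCommGroup B] [NormedSpace ℝ B] [CompleteSpace B]
  [SecondCountableTopology B] [MeasurableSpace B] [BorelSpace B]
  (γ : Measure B) [IsGaussian γ]

lemma ae_add_ofDual (hγ : ∀ L : StrongDual ℝ B, ∫ z, L z ∂γ = 0) (g : StrongDual ℝ B)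
    {Q : B → Prop} (h : ∀ᵐ y ∂γ, Q y) : ∀ᵐ y ∂γ, Q (y + CM.incl γ (CM.ofDual γ g)) := by
  have hac : γ.map (fun y => y + CM.incl γ (CM.ofDual γ g)) ≪ γ := by
    rw [map_add_ofDual γ hγ]
    exact withDensity_absolutelyContinuous _ _
  exact ae_of_ae_map (by fun_prop) (hac.ae_le h)

/-- Along `C_γ g`, `g ∈ B*`, the density of the shift of `γ` by `x` grows exponentially with
rate `g x`. -/
lemma rnDeriv_map_add_shift (hγ : ∀ L : StrongDual ℝ B, ∫ z, L z ∂γ = 0) {x : B}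
    (hx : x ∈ cameronMartin γ) (g : StrongDual ℝ B) :
    ∀ᵐ y ∂γ, (γ.map (fun z => z + x)).rnDeriv γ (y + CM.incl γ (CM.ofDual γ g)) =
      ENNReal.ofReal (Real.exp (g x)) * (γ.map (fun z => z + x)).rnDeriv γ y := by
  set h := CM.incl γ (CM.ofDual γ g) with hh
  set ρ := (γ.map (fun z => z + x)).rnDeriv γ with hρ
  have hρm : Measurable ρ := Measure.measurable_rnDeriv _ _
  have : IsProbabilityMeasure (γ.map (fun z => z + x)) :=
    Measure.isProbabilityMeasure_map (by fun_prop)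
  have hρd : γ.withDensity ρ = γ.map (fun z => z + x) :=
    Measure.withDensity_rnDeriv_eq _ _ (map_add_absolutelyContinuous γ hγ hx)
  set W : B → ℝ≥0∞ := fun y => ENNReal.ofReal (Real.exp ((-g) y - Var[⇑(-g); γ] / 2)) with hW
  have hWm : Measurable W := by fun_prop
  have hWd : γ.map (fun y => y + -h) = γ.withDensity W := by
    rw [hW, ← map_add_ofDual γ hγ, map_neg, map_neg]
  have hT (w : B) : Measurable (fun y : B => y + w) := by fun_prop
  have hWx (y : B) : W (y + -x) = ENNReal.ofReal (Real.exp (g x)) * W y := by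
    rw [← ENNReal.ofReal_mul (Real.exp_nonneg _), ← Real.exp_add]
    simp only [hW, neg_apply, map_add, map_neg]
    ring_nf
  have hρh : Measurable (fun y => ρ (y + h)) := hρm.comp (hT h)
  have hWs : Measurable (fun y => W (y + -x)) := hWm.comp (hT (-x))
  -- The density of `γ` shifted by `x - h` is computed in two orders: by `x` and then `-h` here, by
  -- `-h` and then `x` in `e2`. Comparing the two and cancelling `W` gives the identity without an
  -- explicit formula for `ρ`.
  have e1 : γ.withDensity (W * fun y => ρ (y + h)) =
      (γ.map (fun z => z + x)).map (fun y => y + -h) := by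
    rw [withDensity_mul _ hWm hρh, ← hWd,
      ← map_withDensity_comp _ (hT (-h)) hρh, ← hρd]
    congr 2
    ext y
    simp
  have e2 : γ.withDensity (ρ * fun y => W (y + -x)) =
      (γ.map (fun z => z + x)).map (fun y => y + -h) := by
    rw [withDensity_mul _ hρm hWs, hρd,
      ← map_withDensity_comp _ (hT x) hWs]
    have : ((fun y => W (y + -x)) ∘ fun z => z + x) = W := by
      ext y
      simp
    rw [this, ← hWd, Measure.map_map (hT _) (hT _), Measure.map_map (hT _) (hT _)]
    congr 1
    ext y
    simp only [Function.comp_apply]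
    abel
  have : IsProbabilityMeasure ((γ.map (fun z => z + x)).map (fun y => y + -h)) :=
    Measure.isProbabilityMeasure_map (by fun_prop)
  have hae : (W * fun y => ρ (y + h)) =ᵐ[γ] (ρ * fun y => W (y + -x)) := by
    refine (withDensity_eq_iff (hWm.mul hρh).aemeasurable
      (hρm.mul hWs).aemeasurable ?_).mp (e1.trans e2.symm)
    rw [← setLIntegral_univ, ← withDensity_apply _ MeasurableSet.univ, e1]
    exact measure_ne_top _ _
  filter_upwards [hae] with y hy
  simp only [Pi.mul_apply, hWx] at hy
  have hW0 : W y ≠ 0 := by simp [hW, Real.exp_pos]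
  have hWt : W y ≠ ∞ := ENNReal.ofReal_ne_top
  rw [← ENNReal.mul_right_inj hW0 hWt, hy]
  ring

end Tweedie

/-! ### Norming functionals and directional derivatives. -/

namespace Tweedie

/-- Norming functionals of a dense sequence suffice. Countability keeps the union of exceptional
sets null. -/
lemma exists_seq_norming (E : Type*) [NormedAddCommGroup E] [NormedSpace ℝ E]
    [SecondCountableTopology E] :
    ∃ L : ℕ → StrongDual ℝ E, (∀ n, ‖L n‖ ≤ 1) ∧
      ∀ (x : E) (c : ℝ), (∀ n, L n x ≤ c) → ‖x‖ ≤ c := by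
  choose L hL hLx using fun n => exists_dual_vector'' ℝ (TopologicalSpace.denseSeq E n)
  refine ⟨L, hL, fun x c hc => le_of_forall_pos_le_add fun ε hε => ?_⟩
  obtain ⟨n, hn⟩ := (TopologicalSpace.denseRange_denseSeq E).exists_dist_lt x (half_pos hε)
  set d := TopologicalSpace.denseSeq E n
  rw [dist_eq_norm] at hn
  have h1 : L n d = ‖d‖ := hLx n
  have h2 : L n (d - x) ≤ ‖x - d‖ := by
    rw [← norm_neg (x - d), neg_sub]
    exact (le_abs_self _).trans ((L n).le_of_opNorm_le (hL n) _ |>.trans_eq (one_mul _))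
  have h3 : ‖x‖ ≤ ‖d‖ + ‖x - d‖ := by
    simpa using norm_add_le d (x - d)
  rw [map_sub] at h2
  linarith [hc n]

/-- The set where the moment generating function is finite is convex, so finiteness at `±1` puts `0`
in its interior, where differentiation under the integral is allowed. -/
lemma hasDerivAt_log_lintegral_exp {α : Type*} [MeasurableSpace α] {m : Measure α}
    [IsFiniteMeasure m] (hm : m ≠ 0) {l : α → ℝ} (hl : Measurable l)
    (hpos : ∫⁻ x, ENNReal.ofReal (Real.exp (1 * l x)) ∂m ≠ ∞)
    (hneg : ∫⁻ x, ENNReal.ofReal (Real.exp (-1 * l x)) ∂m ≠ ∞) :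
    HasDerivAt (fun t : ℝ => Real.log (∫⁻ x, ENNReal.ofReal (Real.exp (t * l x)) ∂m).toReal)
      ((∫ x, l x ∂m) / m.real Set.univ) 0 := by
  have hmgf : (fun t : ℝ => (∫⁻ x, ENNReal.ofReal (Real.exp (t * l x)) ∂m).toReal) = mgf l m := by
    ext t
    rw [mgf, integral_eq_lintegral_of_nonneg_ae (Filter.Eventually.of_forall fun x =>
      (Real.exp_pos _).le) (by fun_prop)]
  have hint (t : ℝ) (ht : ∫⁻ x, ENNReal.ofReal (Real.exp (t * l x)) ∂m ≠ ∞) :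
      t ∈ integrableExpSet l m := by
    refine ⟨by fun_prop, ?_⟩
    rw [hasFiniteIntegral_iff_ofReal (Filter.Eventually.of_forall fun x => (Real.exp_pos _).le)]
    exact lt_top_iff_ne_top.mpr ht
  have h0 : (0 : ℝ) ∈ interior (integrableExpSet l m) := by
    rw [mem_interior_iff_mem_nhds]
    refine Filter.mem_of_superset (Icc_mem_nhds (a := -1) (b := 1) (by norm_num) (by norm_num)) ?_
    exact convex_integrableExpSet.ordConnected.out (hint _ hneg) (hint _ hpos)
  have hd := hasDerivAt_mgf h0
  have hm0 : mgf l m 0 = m.real Set.univ := mgf_zero'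
  have hmpos : m.real Set.univ ≠ 0 := by
    simpa [measureReal_def, ENNReal.toReal_eq_zero_iff] using hm
  have := hd.log (by rwa [hm0])
  rw [hm0] at this
  simp only [zero_mul, Real.exp_zero, mul_one] at this
  rw [← hmgf] at this
  exact this

variable {B : Type*} [NormedAddCommGroup B] [NormedSpace ℝ B] [CompleteSpace B]
  [SecondCountableTopology B] [MeasurableSpace B] [BorelSpace B]
  (γ : Measure B) [IsGaussian γ]

/-- As both derivatives exist, they can be compared along the rational sequence `1 / (n + 1)`;
agreement at irrational `t` is not needed. -/
lemma derivAlong_ofDual_eq {f : B → ℝ} {y : B} (hf : DifferentiableAlongAt γ f y)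
    (g : StrongDual ℝ B) {F : ℝ → ℝ} {d : ℝ} (hF : HasDerivAt F d 0)
    (hfF : ∀ t : ℚ, f (y + CM.incl γ (CM.ofDual γ ((t : ℝ) • g))) = F t) :
    derivAlong γ f y (CM.ofDual γ g) = d := by
  have h1 : HasFDerivAt (fun h : CM γ => f (y + CM.incl γ h)) (derivAlong γ f y)
      ((0 : ℝ) • CM.ofDual γ g) := by
    rw [zero_smul]
    exact DifferentiableAt.hasFDerivAt hf
  have h2 : HasDerivAt (fun t : ℝ => t • CM.ofDual γ g) (CM.ofDual γ g) 0 := by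
    simpa using (hasDerivAt_id (0 : ℝ)).smul_const (CM.ofDual γ g)
  have h3 := (h1.comp_hasDerivAt (0 : ℝ) h2).tendsto_slope_zero
  have h4 := hF.tendsto_slope_zero
  let u : ℕ → ℚ := fun n => 1 / ((n : ℚ) + 1)
  have hu : Filter.Tendsto (fun n => (u n : ℝ)) Filter.atTop (nhdsWithin 0 {0}ᶜ) := by
    refine tendsto_nhdsWithin_iff.mpr ⟨?_, Filter.Eventually.of_forall fun n => ?_⟩
    · simpa [u] using tendsto_one_div_add_atTop_nhds_zero_nat (𝕜 := ℝ)
    · have : (0 : ℝ) < u n := by simp only [u]; push_cast; positivity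
      exact this.ne'
  refine tendsto_nhds_unique (h3.comp hu) ((h4.comp hu).congr fun n => ?_)
  have e (t : ℚ) : f (y + CM.incl γ ((t : ℝ) • CM.ofDual γ g)) = F t := by
    rw [← hfF, map_smul (CM.ofDual γ)]
  have e0 := e 0
  simp only [Rat.cast_zero] at e0
  simp only [Function.comp_apply, zero_add, e, e0]

/-! ### The joint law of `(X + Z, X)` and its shifts. -/

variable {Ω : Type*} [MeasurableSpace Ω] {P : Measure Ω} [IsProbabilityMeasure P] {μ : Measure B}
  {p : B → B → ℝ}

lemma map_add_eq_withDensity (hγ : ∀ L : StrongDual ℝ B, ∫ z, L z ∂γ = 0)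
    {x : B} (hx : x ∈ cameronMartin γ) {r : B → ℝ}
    (hr : r =ᵐ[γ] fun y => ((γ.map (fun z => z + x)).rnDeriv γ y).toReal) :
    γ.map (fun z => z + x) = γ.withDensity (fun y => ENNReal.ofReal (r y)) := by
  have : IsProbabilityMeasure (γ.map (fun z => z + x)) :=
    Measure.isProbabilityMeasure_map (by fun_prop)
  rw [← Measure.withDensity_rnDeriv_eq _ _ (map_add_absolutelyContinuous γ hγ hx)]
  refine withDensity_congr_ae ?_
  filter_upwards [hr, Measure.rnDeriv_ne_top (γ.map (fun z => z + x)) γ] with y hy hy'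
  rw [hy, ENNReal.ofReal_toReal hy']

/-- Given `X = x` the sum has law `γ^x`, with density `p x` since `x ∈ H(γ)`; Tonelli then
integrates over `x`. -/
lemma map_add_prodMk_eq_withDensity (hγ : ∀ L : StrongDual ℝ B, ∫ z, L z ∂γ = 0)
    {X Z : Ω → B} (hX : Measurable X) (hZ : Measurable Z)
    (hXμ : P.map X = μ) (hZγ : P.map Z = γ) (hXZ : IndepFun X Z P)
    (hμ : ∀ᵐ x ∂μ, x ∈ cameronMartin γ) (hp : Measurable (Function.uncurry p))
    (hpγ : ∀ᵐ x ∂μ, p x =ᵐ[γ] fun y => ((γ.map (fun z => z + x)).rnDeriv γ y).toReal) :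
    P.map (fun ω => ((X + Z) ω, X ω)) =
      (γ.prod μ).withDensity (Function.uncurry fun y x => ENNReal.ofReal (p x y)) := by
  have : IsProbabilityMeasure μ := hXμ ▸ Measure.isProbabilityMeasure_map hX.aemeasurable
  have hT : Measurable (fun w : B × B => (w.1 + w.2, w.1)) := by fun_prop
  have hjoint : P.map (fun ω => (X ω, Z ω)) = μ.prod γ := by
    rw [(indepFun_iff_map_prod_eq_prod_map_map hX.aemeasurable hZ.aemeasurable).mp hXZ, hXμ, hZγ]
  have hmap : P.map (fun ω => ((X + Z) ω, X ω)) =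
      (μ.prod γ).map (fun w : B × B => (w.1 + w.2, w.1)) := by
    rw [← hjoint, Measure.map_map hT (hX.prodMk hZ)]
    rfl
  have hf : Measurable (Function.uncurry fun y x => ENNReal.ofReal (p x y)) :=
    (hp.comp measurable_swap).ennreal_ofReal
  rw [hmap]
  ext s hs
  rw [withDensity_apply _ hs, ← lintegral_indicator hs,
    lintegral_prod_symm _ (hf.indicator hs).aemeasurable, Measure.map_apply hT hs,
    Measure.prod_apply (hT hs)]
  refine lintegral_congr_ae ?_
  filter_upwards [hμ, hpγ] with x hx hpx
  have hsx : MeasurableSet ((fun y => (y, x)) ⁻¹' s) := measurable_prodMk_right hs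
  have h1 : γ (Prod.mk x ⁻¹' ((fun w : B × B => (w.1 + w.2, w.1)) ⁻¹' s)) =
      γ.map (fun z => z + x) ((fun y => (y, x)) ⁻¹' s) := by
    rw [Measure.map_apply (by fun_prop) hsx]
    congr 1
    ext z
    simp [add_comm]
  rw [h1, map_add_eq_withDensity γ hγ hx hpx, withDensity_apply _ hsx, ← lintegral_indicator hsx]
  rfl

/-- Joint measurability of `p` allows the quantifiers over `x` and `y` to be exchanged, so that `y`
can be fixed first. -/
lemma ae_ae_density_shift [IsFiniteMeasure μ] (hγ : ∀ L : StrongDual ℝ B, ∫ z, L z ∂γ = 0)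
    (hμ : ∀ᵐ x ∂μ, x ∈ cameronMartin γ) (hp : Measurable (Function.uncurry p))
    (hpγ : ∀ᵐ x ∂μ, p x =ᵐ[γ] fun y => ((γ.map (fun z => z + x)).rnDeriv γ y).toReal)
    (g : StrongDual ℝ B) :
    ∀ᵐ y ∂γ, ∀ᵐ x ∂μ, p x (y + CM.incl γ (CM.ofDual γ g)) = Real.exp (g x) * p x y := by
  set h := CM.incl γ (CM.ofDual γ g) with hh
  have hm : MeasurableSet {w : B × B | p w.1 (w.2 + h) = Real.exp (g w.1) * p w.1 w.2} := by
    refine measurableSet_eq_fun ?_ ?_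
    · exact hp.comp (measurable_fst.prodMk (measurable_snd.add_const h))
    · exact (Real.measurable_exp.comp (g.measurable.comp measurable_fst)).mul hp
  refine (Measure.ae_ae_comm hm).mp ?_
  filter_upwards [hμ, hpγ] with x hx hpx
  filter_upwards [hpx, ae_add_ofDual γ hγ g hpx, rnDeriv_map_add_shift γ hγ hx g] with y h1 h2 h3
  rw [h2, h1, h3, ENNReal.toReal_mul, ENNReal.toReal_ofReal (Real.exp_nonneg _)]

end Tweedie

/-! ### Integrability and the logarithmic derivative at a fixed point. -/

namespace Tweedie

variable {B : Type*} [NormedAddCommGroup B] [NormedSpace ℝ B] [CompleteSpace B]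
  [SecondCountableTopology B] [MeasurableSpace B] [BorelSpace B]
  (γ : Measure B) [IsGaussian γ]

/-- At a point `y` where the density `x ↦ p x y` has shifts `exp (t L x) * p x y` along the
directions `C_γ L`, the bound on the derivatives gives a Bochner mean of `p x y μ(dx)`. -/
lemma integrable_id_withDensity {μ : Measure B} {p : B → B → ℝ}
    (hp : Measurable (Function.uncurry p)) {L : ℕ → StrongDual ℝ B} (hL : ∀ n, ‖L n‖ ≤ 1)
    (hLn : ∀ (x : B) (c : ℝ), (∀ n, L n x ≤ c) → ‖x‖ ≤ c) {y : B}
    (hshift : ∀ n, ∀ t : ℚ, ∀ᵐ x ∂μ,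
      p x (y + CM.incl γ (CM.ofDual γ ((t : ℝ) • L n))) = Real.exp (t * L n x) * p x y)
    {ψ : B → ℝ} (hψ : Integrable ψ μ)
    (hD : ∀ᵐ x ∂μ, DifferentiableAlongAt γ (p x) y ∧ ‖derivAlong γ (p x) y‖ ≤ ψ x) :
    Integrable (fun x : B => x) (μ.withDensity fun x => ENNReal.ofReal (p x y)) := by
  have hpy : Measurable (fun x => p x y) := hp.of_uncurry_right
  rw [integrable_withDensity_iff_integrable_smul' hpy.ennreal_ofReal (by simp)]
  refine (hψ.mul_const (eLpNorm id 2 γ).toReal).mono' (by fun_prop) ?_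
  have hshift' : ∀ᵐ x ∂μ, ∀ n, ∀ t : ℚ,
      p x (y + CM.incl γ (CM.ofDual γ ((t : ℝ) • L n))) = Real.exp (t * L n x) * p x y :=
    ae_all_iff.mpr fun n => ae_all_iff.mpr fun t => hshift n t
  filter_upwards [hshift', hD] with x hx hDx
  have hle : ‖p x y • x‖ ≤ ψ x * (eLpNorm id 2 γ).toReal := by
    refine hLn _ _ fun n => ?_
    have hder : HasDerivAt (fun t : ℝ => Real.exp (t * L n x) * p x y) (L n x * p x y) 0 := by
      have h := (((hasDerivAt_id (0 : ℝ)).mul_const (L n x)).exp).mul_const (p x y)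
      simpa using h
    have h1 := derivAlong_ofDual_eq γ hDx.1 (L n) hder (hx n)
    rw [map_smul, smul_eq_mul, mul_comm, ← h1]
    calc derivAlong γ (p x) y (CM.ofDual γ (L n))
        ≤ ‖derivAlong γ (p x) y‖ * ‖CM.ofDual γ (L n)‖ :=
          (le_abs_self _).trans ((derivAlong γ (p x) y).le_opNorm _)
      _ ≤ ψ x * (eLpNorm id 2 γ).toReal := by
          refine mul_le_mul hDx.2 ((CM.norm_ofDual_le γ (L n)).trans ?_) (norm_nonneg _)
            ((norm_nonneg (derivAlong γ (p x) y)).trans hDx.2)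
          exact mul_le_of_le_one_left ENNReal.toReal_nonneg (hL n)
  -- `ENNReal.ofReal` keeps only the positive part of `p x y`, which is at most `|p x y|`.
  refine le_trans ?_ hle
  rw [norm_smul, norm_smul]
  gcongr
  rw [ENNReal.toReal_ofReal', Real.norm_eq_abs, Real.norm_eq_abs,
    abs_of_nonneg (le_max_right _ _)]
  exact max_le (le_abs_self _) (abs_nonneg _)

/-- The derivative of the log-density along `C_γ L` at a point where its shifts are given by
the exponential tilts of `p x y μ(dx)`. -/
lemma derivAlong_log_density {μ : Measure B} {p : B → B → ℝ}
    (hp : Measurable (Function.uncurry p)) {L : StrongDual ℝ B} {y : B}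
    (hshift : ∀ t : ℚ, ∀ᵐ x ∂μ,
      p x (y + CM.incl γ (CM.ofDual γ ((t : ℝ) • L))) = Real.exp (t * L x) * p x y)
    {φ : B → ℝ} (hφ : DifferentiableAlongAt γ φ y)
    (hfin : ∀ t : ℚ, ∫⁻ x, ENNReal.ofReal
      (p x (y + CM.incl γ (CM.ofDual γ ((t : ℝ) • L)))) ∂μ ≠ ∞)
    (hlog : ∀ t : ℚ, φ (y + CM.incl γ (CM.ofDual γ ((t : ℝ) • L))) = Real.log
      (∫⁻ x, ENNReal.ofReal (p x (y + CM.incl γ (CM.ofDual γ ((t : ℝ) • L)))) ∂μ).toReal)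
    (h0 : ∫⁻ x, ENNReal.ofReal (p x y) ∂μ ≠ 0) :
    derivAlong γ φ y (CM.ofDual γ L) =
      (∫ x, L x ∂(μ.withDensity fun x => ENNReal.ofReal (p x y))) /
        (∫⁻ x, ENNReal.ofReal (p x y) ∂μ).toReal := by
  have hpy : Measurable (fun x => p x y) := hp.of_uncurry_right
  set m := μ.withDensity fun x => ENNReal.ofReal (p x y) with hm
  have hmu : m Set.univ = ∫⁻ x, ENNReal.ofReal (p x y) ∂μ := by
    rw [hm, withDensity_apply _ MeasurableSet.univ, Measure.restrict_univ]
  -- The shifted mass is the Laplace transform of `L` under `m`. Its finiteness is used at `t = 0`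
  -- for `m` and at `t = ±1` for differentiability.
  have htilt (t : ℚ) : ∫⁻ x, ENNReal.ofReal
      (p x (y + CM.incl γ (CM.ofDual γ ((t : ℝ) • L)))) ∂μ =
      ∫⁻ x, ENNReal.ofReal (Real.exp (t * L x)) ∂m := by
    rw [hm, lintegral_withDensity_eq_lintegral_mul _ hpy.ennreal_ofReal (by fun_prop)]
    refine lintegral_congr_ae ?_
    filter_upwards [hshift t] with x hx
    rw [hx, ENNReal.ofReal_mul (Real.exp_nonneg _), Pi.mul_apply, mul_comm]
  simp only [htilt] at hfin hlog
  have : IsFiniteMeasure m := by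
    refine ⟨?_⟩
    have h := hfin 0
    simp only [Rat.cast_zero, zero_mul, Real.exp_zero, ENNReal.ofReal_one, lintegral_const,
      one_mul] at h
    exact lt_top_iff_ne_top.mpr h
  have hm0 : m ≠ 0 := fun h => h0 (by rw [← hmu, h]; rfl)
  have hd := hasDerivAt_log_lintegral_exp hm0 L.measurable (by simpa using hfin 1)
    (by simpa using hfin (-1))
  rw [measureReal_def, hmu] at hd
  exact derivAlong_ofDual_eq γ hφ L hd hlog

end Tweedie

/-! ### Tweedie's formula. -/

theorem theorem1
    {B : Type*} [NormedAddCommGroup B] [NormedSpace ℝ B] [CompleteSpace B]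
    [SecondCountableTopology B] [MeasurableSpace B] [BorelSpace B]
    {Ω : Type*} [MeasurableSpace Ω] (P : Measure Ω) [IsProbabilityMeasure P]
    (μ γ : Measure B)
    -- `γ` is a centered Gaussian measure
    [IsGaussian γ] (hγ : ∀ L : StrongDual ℝ B, ∫ z, L z ∂γ = 0)
    -- `X ∼ μ` and `Z ∼ γ` are independent
    (X Z : Ω → B) (hX : Measurable X) (hZ : Measurable Z)
    (hXμ : P.map X = μ) (hZγ : P.map Z = γ) (hXZ : IndepFun X Z P)
    -- `μ(H(γ)) = 1` (the set `H(γ)` is Borel)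
    (hμ : ∀ᵐ x ∂μ, x ∈ Tweedie.cameronMartin γ)
    -- `φ` is a version of `log dν/dγ`, `ν = μ ∗ γ`, Fréchet differentiable along `H(γ)`
    (φ : B → ℝ)
    (hφ : φ =ᵐ[γ] fun y => Real.log ((μ.conv γ).rnDeriv γ y).toReal)
    (hφ' : ∀ᵐ y ∂γ, Tweedie.DifferentiableAlongAt γ φ y)
    -- `p x` is a version of `dγ^x/dγ`, measurable in both variables
    (p : B → B → ℝ) (hp : Measurable (Function.uncurry p))
    (hpγ : ∀ᵐ x ∂μ, p x =ᵐ[γ] fun y => ((γ.map (fun z => z + x)).rnDeriv γ y).toReal)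
    -- its derivatives along `H(γ)` at `y` are bounded by a `μ`-integrable function of `x`
    (hp' : ∀ᵐ y ∂γ, ∃ ψ : B → ℝ, Integrable ψ μ ∧
      ∀ᵐ x ∂μ, Tweedie.DifferentiableAlongAt γ (p x) y ∧ ‖Tweedie.derivAlong γ (p x) y‖ ≤ ψ x) :
    -- `E[X | Y = y]` is the mean of the regular conditional law of `X` given `Y = y`
    (∀ᵐ y ∂(μ.conv γ), Integrable (fun x : B => x) (condDistrib X (X + Z) P y) ∧
      ∫ x, x ∂(condDistrib X (X + Z) P y) =
        Tweedie.CM.incl γ (Tweedie.riesz γ (Tweedie.derivAlong γ φ y))) ∧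
    -- in particular, the formula holds for the conditional expectation of an integrable `X`
    (Integrable X P →
      P[X | MeasurableSpace.comap (X + Z) inferInstance] =ᵐ[P]
        fun ω => Tweedie.CM.incl γ
          (Tweedie.riesz γ (Tweedie.derivAlong γ φ (X ω + Z ω)))) := by

  have hμprob : IsProbabilityMeasure μ := hXμ ▸ Measure.isProbabilityMeasure_map hX.aemeasurable
  have hY : Measurable (X + Z) := hX.add hZ
  set f : B → B → ℝ≥0∞ := fun y x => ENNReal.ofReal (p x y) with hf
  have hfm : Measurable (Function.uncurry f) := (hp.comp measurable_swap).ennreal_ofReal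
  set q : B → ℝ≥0∞ := fun y => ∫⁻ x, f y x ∂μ with hq
  have hqm : Measurable q := hfm.lintegral_prod_right'
  have hjoint := Tweedie.map_add_prodMk_eq_withDensity γ hγ hX hZ hXμ hZγ hXZ hμ hp hpγ
  have hν : P.map (X + Z) = μ.conv γ := by
    rw [hXZ.map_add_eq_map_conv_map hX hZ, hXμ, hZγ]
  have hνq : μ.conv γ = γ.withDensity q :=
    hν ▸ Tweedie.map_eq_withDensity_lintegral hX hY hfm hjoint
  have hbayes := Tweedie.condDistrib_ae_eq_withDensity hX hY hfm hjoint
  rw [hν] at hbayes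
  have hνprob : IsProbabilityMeasure (μ.conv γ) :=
    hν ▸ Measure.isProbabilityMeasure_map hY.aemeasurable
  have hqtop : ∀ᵐ y ∂γ, q y < ∞ := by
    refine ae_lt_top hqm ?_
    rw [← setLIntegral_univ, ← withDensity_apply _ MeasurableSet.univ, ← hνq]
    exact measure_ne_top _ _
  have hφq : ∀ᵐ y ∂γ, φ y = Real.log (q y).toReal ∧ q y ≠ ∞ := by
    have h := Measure.rnDeriv_withDensity γ hqm
    rw [← hνq] at h
    filter_upwards [hφ, h, hqtop] with y h1 h2 h3
    rw [h1, h2]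
    exact ⟨rfl, h3.ne⟩
  obtain ⟨L, hL, hLn⟩ := Tweedie.exists_seq_norming B
  have hshift : ∀ᵐ y ∂γ, ∀ n, ∀ t : ℚ, ∀ᵐ x ∂μ,
      p x (y + Tweedie.CM.incl γ (Tweedie.CM.ofDual γ ((t : ℝ) • L n))) =
        Real.exp (t * L n x) * p x y :=
    ae_all_iff.mpr fun n => ae_all_iff.mpr fun t =>
      Tweedie.ae_ae_density_shift γ hγ hμ hp hpγ ((t : ℝ) • L n)
  have hφshift : ∀ᵐ y ∂γ, ∀ n, ∀ t : ℚ,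
      φ (y + Tweedie.CM.incl γ (Tweedie.CM.ofDual γ ((t : ℝ) • L n))) =
        Real.log (q (y + Tweedie.CM.incl γ (Tweedie.CM.ofDual γ ((t : ℝ) • L n)))).toReal ∧
      q (y + Tweedie.CM.incl γ (Tweedie.CM.ofDual γ ((t : ℝ) • L n))) ≠ ∞ :=
    ae_all_iff.mpr fun n => ae_all_iff.mpr fun t =>
      Tweedie.ae_add_ofDual γ hγ ((t : ℝ) • L n) hφq
  have hac : μ.conv γ ≪ γ := hνq ▸ withDensity_absolutelyContinuous _ _
  have hq0 : ∀ᵐ y ∂(μ.conv γ), q y ≠ 0 := by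
    rw [hνq, ae_withDensity_iff hqm]
    exact Filter.Eventually.of_forall fun _ h => h
  have main : ∀ᵐ y ∂(μ.conv γ), Integrable (fun x : B => x) (condDistrib X (X + Z) P y) ∧
      ∫ x, x ∂(condDistrib X (X + Z) P y) =
        Tweedie.CM.incl γ (Tweedie.riesz γ (Tweedie.derivAlong γ φ y)) := by
    filter_upwards [hbayes, hq0, hac.ae_le hqtop, hac.ae_le hshift, hac.ae_le hφshift,
      hac.ae_le hφ', hac.ae_le hp'] with y hy hy0 hytop hys hyφ hyd hyψ
    obtain ⟨ψ, hψ, hD⟩ := hyψ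
    have hint := Tweedie.integrable_id_withDensity γ hp hL hLn hys hψ hD
    have hcond : condDistrib X (X + Z) P y = (q y)⁻¹ • μ.withDensity (f y) := by
      rw [hy, ← withDensity_smul _ hfm.of_uncurry_left]
      congr with x
      exact mul_comm _ _
    have hint' : Integrable (fun x : B => x) (condDistrib X (X + Z) P y) := by
      rw [hcond]
      exact hint.smul_measure (ENNReal.inv_ne_top.mpr hy0)
    refine ⟨hint', ?_⟩
    rw [← sub_eq_zero, ← norm_le_zero_iff]
    -- Each `L n` vanishes on the difference of the two sides, so its norm is at most `0`.
    refine hLn _ _ fun n => le_of_eq ?_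
    have hder := Tweedie.derivAlong_log_density γ hp (hys n) hyd (fun t => (hyφ n t).2)
      (fun t => (hyφ n t).1) hy0
    rw [map_sub, sub_eq_zero, ← (L n).integral_comp_comm hint', ← Tweedie.CM.inner_ofDual,
      Tweedie.riesz, InnerProductSpace.toDual_symm_apply, hder, hcond, integral_smul_measure,
      ENNReal.toReal_inv, smul_eq_mul, div_eq_inv_mul]
  refine ⟨main, fun hXint => ?_⟩
  rw [← hν] at main
  filter_upwards [condExp_ae_eq_integral_condDistrib' hY hXint,
    ae_of_ae_map hY.aemeasurable main] with ω h1 h2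
  rw [h1, h2.2]
  rfl
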